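/- Let $M$ be a smooth ($C^\infty$) manifold and, for an integer $h\ge 0$, let $\mathbf T_h^{big}M=(TM\times\mathbb R^h)\oplus(T^*M\times\mathbb R^h)$, with elements $(X,u)\oplus(\alpha,v)$ and the neutral metric $$G\big((X_1,u_1)\oplus(\alpha_1,v_1),(X_2,u_2)\oplus(\alpha_2,v_2)\big)=\tfrac12\big(\alpha_2(X_1)+\alpha_1(X_2)+u_1\cdot v_2+u_2\cdot v_1\big).$$ Given $c\in\mathbb R^h$ and the linear function $\tau=\sum_{a=1}^h c_at^a$ on $\mathbb R^h$, write $d\tau(u)=c\cdot u$ and regard $d\tau$ also as the vector $c\in\mathbb R^h$. The untwisted Wade (Courant–Jacobi) bracket of smooth sections of $\mathbf T_h^{big}M$ is $$[(X_1,u_1)\oplus(\alpha_1,v_1),(X_2,u_2)\oplus(\alpha_2,v_2)]_W=([X_1,X_2],\,X_1u_2-X_2u_1)\oplus(\beta,\,y),$$ $$\beta=L_{X_1}\alpha_2-L_{X_2}\alpha_1+\tfrac12d\big(\alpha_1(X_2)-\alpha_2(X_1)\big)+d\tau(u_1)\alpha_2-d\tau(u_2)\alpha_1+\tfrac12\big(u_2\cdot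 dv_1+v_2\cdot du_1-u_1\cdot dv_2-v_1\cdot du_2\big),$$ $$y=X_1v_2-X_2v_1+\tfrac12\big(\alpha_1(X_2)-\alpha_2(X_1)+u_2\cdot v_1-u_1\cdot v_2\big)d\tau+d\tau(u_1)v_2-d\tau(u_2)v_1 .$$ An untwisted stable Dirac–Jacobi structure of index $h$ with respect to $\tau$ is a smooth subbundle $J\subseteq\mathbf T_h^{big}M$ whose fibres are maximally $G$-isotropic and whose space $\Gamma J$ of smooth global cross sections is closed under this bracket. Proposition 2.3. Let $J\subseteq\mathbf T_h^{big}M$ be an untwisted stable Dirac–Jacobi structure of index $h$ with respect to the linear function $\tau=\sum_{a=1}^hc_at^a$, and let $V_1,\dots,V_k$ be smooth vector fields on $M$ with $[V_p,V_q]=0$ for all $p,q$ such that, for every $p$, $$(X,u)\oplus(\alpha,v)\in\Gamma J\ \Longrightarrow\ \big([V_p,X]+d\tau(u)V_p,\;V_p(u)\big)\oplus\big(L_{V_p}\alpha,\;V_p(v)-\alpha(V_p)\,d\tau\big)\in\Gamma J .$$ Put $w\cdot V=\sum_{p=1}^k w_pV_p$ and $\alpha(V)=(\alpha(V_1),\dots,\alpha(V_k))$.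 Then $$\hat J=\{(X-w\cdot V,\,u,\,\alpha(V))\oplus(\alpha,\,v,\,w)\ :\ (X,u)\oplus(\alpha,v)\in J,\ w\in\mathbb R^k\}$$ is an untwisted stable Dirac–Jacobi structure of index $h+k$, with respect to the same $\tau$ regarded as a function on $\mathbb R^{h+k}=\mathbb R^h\times\mathbb R^k$ that does not depend on the last $k$ coordinates. -/

import Mathlib

open Set Bundle VectorField
open scoped Topology Manifold ContDiff

noncomputable section

namespace StableDJ

variable {E : Type*} [NormedAddCommGroup E] [NormedSpace ℝ E]
  {H : Type*} [TopologicalSpace H] (I : ModelWithCorners ℝ E H)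
  {M : Type*} [TopologicalSpace M] [ChartedSpace H M] [IsManifold I ∞ M]

/-- The fibre at `x` of the stable big tangent bundle `(TM × ℝʰ) ⊕ (T*M × ℝʰ)` of index `h`.
Its elements are written `((X, u), (α, v))`. -/
abbrev BigTangent (h : ℕ) (x : M) : Type _ :=
  (TangentSpace I x × (Fin h → ℝ)) × ((TangentSpace I x →L[ℝ] ℝ) × (Fin h → ℝ))

/-- The neutral metric `G` on a fibre of the stable big tangent bundle. -/
def metricG {h : ℕ} {x : M} (a b : BigTangent I h x) : ℝ :=
  (1 / 2 : ℝ) * (b.2.1 a.1.1 + a.2.1 b.1.1 + a.1.2 ⬝ᵥ b.2.2 + b.1.2 ⬝ᵥ a.2.2)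

/-- A subspace of a fibre is isotropic if `G` vanishes identically on it. -/
def IsIsotropic {h : ℕ} {x : M} (S : Submodule ℝ (BigTangent I h x)) : Prop :=
  ∀ a ∈ S, ∀ b ∈ S, metricG I a b = 0

/-- A (not necessarily continuous) section `x ↦ (X x, u x) ⊕ (α x, v x)` of the stable big tangent
bundle is smooth on `U` if its four components are: the vector field `X`, the `ℝʰ`-valued function
`u`, the `1`-form `α` (as a section of the bundle of continuous linear maps from the tangent bundle
to `ℝ`), and the `ℝʰ`-valued function `v`. -/
def SmoothSectionOn {h : ℕ} (s : Π x : M, BigTangent I h x) (U : Set M) : Prop :=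
  ContMDiffOn I I.tangent ∞ (fun x ↦ (⟨x, (s x).1.1⟩ : TangentBundle I M)) U ∧
  ContMDiffOn I 𝓘(ℝ, Fin h → ℝ) ∞ (fun x ↦ (s x).1.2) U ∧
  ContMDiffOn I (I.prod 𝓘(ℝ, E →L[ℝ] ℝ)) ∞
    (fun x ↦ TotalSpace.mk' (E →L[ℝ] ℝ) (E := fun y : M ↦ TangentSpace I y →L[ℝ] ℝ)
      x (s x).2.1) U ∧
  ContMDiffOn I 𝓘(ℝ, Fin h → ℝ) ∞ (fun x ↦ (s x).2.2) U

/-- `s ∈ Γ J`: the section `s` is a smooth global cross section of `J`. -/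
def IsSectionOf {h : ℕ} (J : Π x : M, Submodule ℝ (BigTangent I h x))
    (s : Π x : M, BigTangent I h x) : Prop :=
  SmoothSectionOn I s univ ∧ ∀ x, s x ∈ J x

/-- A family of subspaces of the fibres is a smooth subbundle if, near every point, it has a
finite frame of smooth local sections. -/
def IsSmoothSubbundle {h : ℕ} (J : Π x : M, Submodule ℝ (BigTangent I h x)) : Prop :=
  ∀ x₀ : M, ∃ U : Set M, IsOpen U ∧ x₀ ∈ U ∧ ∃ (r : ℕ) (s : Fin r → Π x : M, BigTangent I h x),
    (∀ i, SmoothSectionOn I (s i) U) ∧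
    ∀ x ∈ U, LinearIndependent ℝ (fun i ↦ s i x) ∧
      Submodule.span ℝ (range fun i ↦ s i x) = J x

/-- The Lie derivative `L_X α` of a `1`-form `α` along a vector field `X`, computed at `x` in the
preferred chart at `x` as `∑ᵢⱼ (Xʲ ∂ⱼ αᵢ + αⱼ ∂ᵢ Xʲ) dxⁱ` and transported back to the manifold.
(The same recipe is used in Mathlib for the Lie bracket of vector fields.) -/
def lieDerivForm (X : Π x : M, TangentSpace I x) (α : Π x : M, TangentSpace I x →L[ℝ] ℝ)
    (x : M) : TangentSpace I x →L[ℝ] ℝ :=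
  let φ := extChartAt I x
  let Xc : E → E := mpullbackWithin 𝓘(ℝ, E) I φ.symm X (range I)
  let αc : E → E →L[ℝ] ℝ := fun z ↦
    (α (φ.symm z)).comp (mfderivWithin 𝓘(ℝ, E) I φ.symm (range I) z)
  ContinuousLinearMap.comp
    (fderivWithin ℝ αc (range I) (φ x) (Xc (φ x)) +
      (αc (φ x)).comp (fderivWithin ℝ Xc (range I) (φ x)))
    (mfderiv I 𝓘(ℝ, E) φ x)

/-- The `1`-form `u · dv = ∑ₐ uᵃ dvᵃ` for `ℝʰ`-valued functions `u`, `v`. -/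
def dotD {h : ℕ} (u v : M → Fin h → ℝ) (x : M) : TangentSpace I x →L[ℝ] ℝ :=
  ∑ a, u x a • mvfderiv I (fun y ↦ v y a) x

/-- The untwisted Wade (Courant-Jacobi) bracket of index `h` defined by the linear function
`τ = ∑ₐ cₐ tᵃ` on `ℝʰ`; here `d₀τ(u) = c · u`, and `d₀τ` is the vector `c` of `ℝʰ`. -/
def wadeBracket {h : ℕ} (c : Fin h → ℝ) (s₁ s₂ : Π x : M, BigTangent I h x) (x : M) :
    BigTangent I h x :=
  let X₁ := fun y ↦ (s₁ y).1.1
  let u₁ := fun y ↦ (s₁ y).1.2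
  let α₁ := fun y ↦ (s₁ y).2.1
  let v₁ := fun y ↦ (s₁ y).2.2
  let X₂ := fun y ↦ (s₂ y).1.1
  let u₂ := fun y ↦ (s₂ y).1.2
  let α₂ := fun y ↦ (s₂ y).2.1
  let v₂ := fun y ↦ (s₂ y).2.2
  ((mlieBracket I X₁ X₂ x,
    mvfderiv I u₂ x (X₁ x) - mvfderiv I u₁ x (X₂ x)),
   (lieDerivForm I X₁ α₂ x - lieDerivForm I X₂ α₁ x
      + (1 / 2 : ℝ) • mvfderiv I (fun y ↦ α₁ y (X₂ y) - α₂ y (X₁ y)) x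
      + (c ⬝ᵥ u₁ x) • α₂ x - (c ⬝ᵥ u₂ x) • α₁ x
      + (1 / 2 : ℝ) • (dotD I u₂ v₁ x + dotD I v₂ u₁ x - dotD I u₁ v₂ x - dotD I v₁ u₂ x),
    mvfderiv I v₂ x (X₁ x) - mvfderiv I v₁ x (X₂ x)
      + ((1 / 2 : ℝ) * (α₁ x (X₂ x) - α₂ x (X₁ x) + u₂ x ⬝ᵥ v₁ x - u₁ x ⬝ᵥ v₂ x)) • c
      + (c ⬝ᵥ u₁ x) • v₂ x - (c ⬝ᵥ u₂ x) • v₁ x))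

/-- `J` is an untwisted stable Dirac-Jacobi structure of index `h` with respect to the linear
function `τ = ∑ₐ cₐ tᵃ`: a smooth subbundle with maximally isotropic fibres whose space of smooth
global cross sections is closed under the Wade bracket. (The bracket of smooth sections is smooth,
so closure says that its values lie in `J`.) -/
structure IsDiracJacobi {h : ℕ} (c : Fin h → ℝ)
    (J : Π x : M, Submodule ℝ (BigTangent I h x)) : Prop where
  subbundle : IsSmoothSubbundle I J
  maximal_isotropic : ∀ x, Maximal (IsIsotropic I) (J x)
  integrable : ∀ s₁ s₂, IsSectionOf I J s₁ → IsSectionOf I J s₂ →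
    ∀ x, wadeBracket I c s₁ s₂ x ∈ J x

/-- The twisted invariance condition for a vector field `V`: if `(X, u) ⊕ (α, v) ∈ Γ J`, then
`([V, X] + dτ(u) V, V(u)) ⊕ (L_V α, V(v) - α(V) dτ) ∈ Γ J`, where `τ = ∑ₐ cₐ tᵃ`. -/
def TwistedInvariant {h : ℕ} (c : Fin h → ℝ) (J : Π x : M, Submodule ℝ (BigTangent I h x))
    (V : Π x : M, TangentSpace I x) : Prop :=
  ∀ s, IsSectionOf I J s → ∀ x,
    (((mlieBracket I V (fun y ↦ (s y).1.1) x + (c ⬝ᵥ (s x).1.2) • V x,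
        mvfderiv I (fun y ↦ (s y).1.2) x (V x)),
      (lieDerivForm I V (fun y ↦ (s y).2.1) x,
        mvfderiv I (fun y ↦ (s y).2.2) x (V x) - (s x).2.1 (V x) • c)) :
      BigTangent I h x) ∈ J x

/-- The prolongation
`Ĵ = {(X - w · V, u, α(V)) ⊕ (α, v, w) | (X, u) ⊕ (α, v) ∈ J, w ∈ ℝᵏ}`. -/
def prolongation {h k : ℕ} (J : Π x : M, Submodule ℝ (BigTangent I h x))
    (V : Fin k → Π x : M, TangentSpace I x) (x : M) :
    Submodule ℝ (BigTangent I (h + k) x) where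
  carrier := {z | ∃ (X : TangentSpace I x) (u : Fin h → ℝ) (α : TangentSpace I x →L[ℝ] ℝ)
    (v : Fin h → ℝ) (w : Fin k → ℝ), (((X, u), (α, v)) : BigTangent I h x) ∈ J x ∧
      z = ((X - ∑ p, w p • V p x, Fin.append u (fun p ↦ α (V p x))), (α, Fin.append v w))}
  zero_mem' := by
    refine ⟨0, 0, 0, 0, 0, (J x).zero_mem, ?_⟩
    ext1 <;> ext1
    · simp
    · funext i; refine Fin.addCases (fun j ↦ ?_) (fun j ↦ ?_) i <;> simp
    · simp
    · funext i; refine Fin.addCases (fun j ↦ ?_) (fun j ↦ ?_) i <;> simp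
  add_mem' := by
    rintro _ _ ⟨X, u, α, v, w, hJ, rfl⟩ ⟨X', u', α', v', w', hJ', rfl⟩
    refine ⟨X + X', u + u', α + α', v + v', w + w', (J x).add_mem hJ hJ', ?_⟩
    ext1 <;> ext1
    · simp only [Prod.fst_add, Pi.add_apply, add_smul, Finset.sum_add_distrib]
      abel
    · funext i; refine Fin.addCases (fun j ↦ ?_) (fun j ↦ ?_) i <;> simp
    · simp
    · funext i; refine Fin.addCases (fun j ↦ ?_) (fun j ↦ ?_) i <;> simp
  smul_mem' := by
    rintro r _ ⟨X, u, α, v, w, hJ, rfl⟩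
    refine ⟨r • X, r • u, r • α, r • v, r • w, (J x).smul_mem r hJ, ?_⟩
    ext1 <;> ext1
    · simp only [Prod.smul_fst, Pi.smul_apply, smul_sub, Finset.smul_sum, smul_smul, smul_eq_mul]
    · funext i; refine Fin.addCases (fun j ↦ ?_) (fun j ↦ ?_) i <;> simp
    · simp
    · funext i; refine Fin.addCases (fun j ↦ ?_) (fun j ↦ ?_) i <;> simp

end StableDJ

end

/-! The prolongation is the image of `J × ℝᵏ` under a fibrewise linear map P = `prolongMap`. It is
injective, since `unprolong` recovers the `J`-part and the last `k` coordinates of `v` give `w`. It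
also pulls `G` back to `G` on the first factor (`metricG_prolongMap`): the pairing of α(V) with w'
cancels the contribution of -w'·V. Hence a smooth frame of `J` together with the standard basis of
`ℝᵏ` gives a frame of Ĵ, and Ĵ is isotropic. For maximality, orthogonality to P(0, e_p) forces the
extra coordinates of `u` to be α(V), which characterizes the range of P, and the question descends
to the maximality of `J`.

For the bracket, write T_p for the action of V_p in the invariance hypothesis (`twistedLie`). Since
the V_p commute, the `J`-part of the bracket of P(s₁, w₁) and P(s₂, w₂) is [s₁, s₂] + Σ w₂ᵖ T_p s₁ -
Σ w₁ᵖ T_p s₂ (`unprolong_wadeBracket`), which lies in `J` by integrability and invariance. It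
remains to see that the extra coordinates of `u` are the values of the new form on the V_q. For [s₁,
s₂] this is `wadeBracket_form_apply`, which uses G(T_q s₁, s₂) = G(T_q s₂, s₁) = 0; for the
correction terms it is (L_{V_p} α)(V_q) = V_p(α(V_q)), again by commutation. -/

noncomputable section

/-! ### Forms and fields in a chart; Cartan's formula. -/

namespace StableDJ

variable {E : Type*} [NormedAddCommGroup E] [NormedSpace ℝ E]
  {H : Type*} [TopologicalSpace H] (I : ModelWithCorners ℝ E H)
  {M : Type*} [TopologicalSpace M] [ChartedSpace H M] [IsManifold I ∞ M]

/-- A `1`-form read in the extended chart at `x`. -/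
def formInChart (α : Π x : M, TangentSpace I x →L[ℝ] ℝ) (x : M) (z : E) : E →L[ℝ] ℝ :=
  (α ((extChartAt I x).symm z)).comp
    (mfderivWithin 𝓘(ℝ, E) I (extChartAt I x).symm (range I) z)

/-- A vector field read in the extended chart at `x`. -/
def fieldInChart (X : Π x : M, TangentSpace I x) (x : M) (z : E) : E :=
  mpullbackWithin 𝓘(ℝ, E) I (extChartAt I x).symm X (range I) z

/-- Differentiability of a `1`-form at a point. -/
def MDiffFormAt (α : Π x : M, TangentSpace I x →L[ℝ] ℝ) (x : M) : Prop :=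
  MDifferentiableAt I (I.prod 𝓘(ℝ, E →L[ℝ] ℝ))
    (fun x ↦ TotalSpace.mk' (E →L[ℝ] ℝ) (E := fun y : M ↦ TangentSpace I y →L[ℝ] ℝ) x (α x)) x

/-- Differentiability of a vector field at a point. -/
def MDiffFieldAt (X : Π x : M, TangentSpace I x) (x : M) : Prop :=
  MDifferentiableAt I I.tangent (fun x ↦ (⟨x, X x⟩ : TangentBundle I M)) x

variable {I}
lemma formInChart_self (α : Π x : M, TangentSpace I x →L[ℝ] ℝ) (x : M) :
    formInChart I α x (extChartAt I x x) = α x := by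
  have : IsManifold I 1 M := .of_le (n := ∞) (by simp)
  -- Going through the chart and back returns `x` only propositionally, so the fibres are compared
  -- through their common model `E`.
  have aux : ∀ y, y = x → ∀ v : E, (α y : E →L[ℝ] ℝ) v = (α x : E →L[ℝ] ℝ) v := by
    rintro _ rfl _; rfl
  ext v
  have h : (mfderivWithin 𝓘(ℝ, E) I (extChartAt I x).symm (range I) (extChartAt I x x) :
      E →L[ℝ] E) v = v := congrArg (fun A : E →L[ℝ] E ↦ A v) mfderivWithin_range_extChartAt_symm
  refine Eq.trans ?_ (aux _ (extChartAt_to_inv (I := I) x) v)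
  exact congrArg (α ((extChartAt I x).symm (extChartAt I x x)) : E →L[ℝ] ℝ) h

lemma fieldInChart_self (X : Π x : M, TangentSpace I x) (x : M) :
    fieldInChart I X x (extChartAt I x x) = X x := by
  have : IsManifold I 1 M := .of_le (n := ∞) (by simp)
  have aux : ∀ y, y = x → (X y : E) = (X x : E) := by
    rintro _ rfl; rfl
  have h : (mfderivWithin 𝓘(ℝ, E) I (extChartAt I x).symm (range I) (extChartAt I x x) :
      E →L[ℝ] E).inverse = ContinuousLinearMap.id ℝ E :=
    (congrArg (fun A : E →L[ℝ] E ↦ A.inverse) mfderivWithin_range_extChartAt_symm).trans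
      ContinuousLinearMap.inverse_id
  refine Eq.trans ?_ (aux _ (extChartAt_to_inv (I := I) x))
  exact congrArg (fun A : E →L[ℝ] E ↦ A (X ((extChartAt I x).symm (extChartAt I x x)))) h

/-- At its own centre the preferred chart has identity derivative, so the transport back to the
manifold disappears and the flat coordinate formula remains. -/
lemma lieDerivForm_eq (X : Π x : M, TangentSpace I x) (α : Π x : M, TangentSpace I x →L[ℝ] ℝ)
    (x : M) (v : E) :
    lieDerivForm I X α x v =
      fderivWithin ℝ (formInChart I α x) (range I) (extChartAt I x x) (X x) v +
      α x (fderivWithin ℝ (fieldInChart I X x) (range I) (extChartAt I x x) v) := by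
  have : IsManifold I 1 M := .of_le (n := ∞) (by simp)
  have hD : (mfderiv I 𝓘(ℝ, E) (extChartAt I x) x : E →L[ℝ] E) = ContinuousLinearMap.id ℝ E :=
    mfderiv_extChartAt_self
  have h : lieDerivForm I X α x v =
      (fun (Y : E) (β : E →L[ℝ] ℝ) (D : E →L[ℝ] E) ↦
        fderivWithin ℝ (formInChart I α x) (range I) (extChartAt I x x) Y (D v) +
        β (fderivWithin ℝ (fieldInChart I X x) (range I) (extChartAt I x x) (D v)))
      (fieldInChart I X x (extChartAt I x x)) (formInChart I α x (extChartAt I x x))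
      (mfderiv I 𝓘(ℝ, E) (extChartAt I x) x : E →L[ℝ] E) := rfl
  rw [h, hD, fieldInChart_self, formInChart_self]
  rfl

lemma mlieBracket_eq (X Y : Π x : M, TangentSpace I x) (x : M) :
    mlieBracket I X Y x =
      fderivWithin ℝ (fieldInChart I Y x) (range I) (extChartAt I x x) (X x) -
      fderivWithin ℝ (fieldInChart I X x) (range I) (extChartAt I x x) (Y x) := by
  have : IsManifold I 1 M := .of_le (n := ∞) (by simp)
  have hD : (mfderiv I 𝓘(ℝ, E) (extChartAt I x) x : E →L[ℝ] E).inverse =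
      ContinuousLinearMap.id ℝ E :=
    (congrArg (fun A : E →L[ℝ] E ↦ A.inverse) mfderiv_extChartAt_self).trans
      ContinuousLinearMap.inverse_id
  have h : mlieBracket I X Y x = (fun (X' Y' : E) (D : E →L[ℝ] E) (s : Set E) ↦
        D (fderivWithin ℝ (fieldInChart I Y x) s (extChartAt I x x) X' -
          fderivWithin ℝ (fieldInChart I X x) s (extChartAt I x x) Y'))
      (fieldInChart I X x (extChartAt I x x)) (fieldInChart I Y x (extChartAt I x x))
      (mfderiv I 𝓘(ℝ, E) (extChartAt I x) x : E →L[ℝ] E).inverse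
      ((extChartAt I x).symm ⁻¹' univ ∩ range I) := rfl
  rw [h, hD, fieldInChart_self, fieldInChart_self, preimage_univ, univ_inter]
  rfl

/-- The form is composed with the derivative of the inverse chart and the field with the inverse of
that derivative, so the two cancel. -/
lemma formInChart_apply_fieldInChart (α : Π x : M, TangentSpace I x →L[ℝ] ℝ)
    (Y : Π x : M, TangentSpace I x) {x : M} {z : E} (hz : z ∈ (extChartAt I x).target) :
    formInChart I α x z (fieldInChart I Y x z) =
      α ((extChartAt I x).symm z) (Y ((extChartAt I x).symm z)) := by
  have : IsManifold I 1 M := .of_le (n := ∞) (by simp)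
  have h := isInvertible_mfderivWithin_extChartAt_symm (I := I) hz
  unfold formInChart fieldInChart
  rw [mpullbackWithin_apply]
  exact congrArg _ (h.self_apply_inverse _)

lemma MDiffFieldAt.differentiableWithinAt [CompleteSpace E] {X : Π x : M, TangentSpace I x} {x : M}
    (hX : MDiffFieldAt I X x) :
    DifferentiableWithinAt ℝ (fieldInChart I X x) (range I) (extChartAt I x x) := by
  have : IsManifold I 2 M := .of_le (n := ∞) (by norm_cast)
  have := (mdifferentiableWithinAt_univ.2
    hX).differentiableWithinAt_mpullbackWithin_vectorField
  rwa [preimage_univ, univ_inter] at this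

lemma MDiffFormAt.differentiableWithinAt {α : Π x : M, TangentSpace I x →L[ℝ] ℝ} {x : M}
    (hα : MDiffFormAt I α x) :
    DifferentiableWithinAt ℝ (formInChart I α x) (range I) (extChartAt I x x) := by
  have : IsManifold I 1 M := .of_le (n := ∞) (by simp)
  have h := ((mdifferentiableAt_hom_bundle _).1 hα).2
  have h2 := h.comp_mdifferentiableWithinAt_of_eq (x := extChartAt I x x) (I := 𝓘(ℝ, E))
    (s := range I) (mdifferentiableWithinAt_extChartAt_symm (mem_extChartAt_target x))
    (extChartAt_to_inv x)
  refine (h2.differentiableWithinAt).congr_of_eventuallyEq_of_mem ?_ (mem_range_self _)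
  filter_upwards [extChartAt_target_mem_nhdsWithin (I := I) x] with z hz
  have hs : (extChartAt I x).symm z ∈ (chartAt H x).source := by
    simpa using (extChartAt I x).map_target hz
  -- The inverse tangent trivialization is the derivative of the inverse chart, so the hom-bundle
  -- coordinates of `α` agree with `formInChart`.
  have hsym := TangentBundle.symmL_trivializationAt (𝕜 := ℝ) (I := I) hs
  rw [(extChartAt I x).right_inv hz] at hsym
  ext v
  have h3 : ∀ (y : M) (r : ℝ), (trivializationAt ℝ (Bundle.Trivial M ℝ) x).continuousLinearMapAt ℝ y
      r = r := fun y r ↦ by simp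
  refine Eq.trans ?_ (h3 _ _).symm
  exact congrArg (fun A : E →L[ℝ] E ↦ (α ((extChartAt I x).symm z) : E →L[ℝ] ℝ) (A v)) hsym.symm

omit [IsManifold I ∞ M] in
lemma mvfderiv_eq_fderivWithin {f : M → ℝ} {x : M} (hf : MDifferentiableAt I 𝓘(ℝ) f x)
    (v : E) : mvfderiv I f x v =
      fderivWithin ℝ (f ∘ (extChartAt I x).symm) (range I) (extChartAt I x x) v := by
  rw [hf.mvfderiv]; rfl

lemma MDiffFormAt.apply {α : Π x : M, TangentSpace I x →L[ℝ] ℝ} {x : M} (hα : MDiffFormAt I α x)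
    {Y : Π x : M, TangentSpace I x} (hY : MDiffFieldAt I Y x) :
    MDifferentiableAt I 𝓘(ℝ) (fun y ↦ α y (Y y)) x := by
  have : IsManifold I 1 M := .of_le (n := ∞) (by simp)
  have := MDifferentiableAt.clm_bundle_apply (F₁ := E) (E₁ := fun y : M ↦ TangentSpace I y)
    (F₂ := ℝ) (E₂ := Bundle.Trivial M ℝ) (ϕ := α) (v := Y) (b := id) hα hY
  rw [mdifferentiableAt_totalSpace] at this
  exact this.2

/-- Cartan's formula `(L_X α)(Y) = X(α(Y)) - α([X, Y])`. -/
lemma lieDerivForm_apply [CompleteSpace E] {X Y : Π x : M, TangentSpace I x}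
    {α : Π x : M, TangentSpace I x →L[ℝ] ℝ} {x : M}
    (hα : MDiffFormAt I α x) (hY : MDiffFieldAt I Y x) :
    lieDerivForm I X α x (Y x) =
      mvfderiv I (fun y ↦ α y (Y y)) x (X x) - α x (mlieBracket I X Y x) := by
  have hu : UniqueDiffWithinAt ℝ (range I) (extChartAt I x x) :=
    I.uniqueDiffOn _ (mem_range_self _)
  have key : fderivWithin ℝ ((fun y ↦ α y (Y y)) ∘ (extChartAt I x).symm) (range I)
      (extChartAt I x x) =
      fderivWithin ℝ (fun z ↦ formInChart I α x z (fieldInChart I Y x z)) (range I)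
        (extChartAt I x x) := by
    apply Filter.EventuallyEq.fderivWithin_eq_of_mem _ (mem_range_self _)
    filter_upwards [extChartAt_target_mem_nhdsWithin (I := I) x] with z hz
    exact (formInChart_apply_fieldInChart α Y hz).symm
  have h1 := lieDerivForm_eq X α x (Y x)
  have h2 := mvfderiv_eq_fderivWithin (hα.apply hY) (X x)
  have h3 := congrArg (α x : E →L[ℝ] ℝ) (mlieBracket_eq X Y x)
  rw [key, fderivWithin_clm_apply hu hα.differentiableWithinAt hY.differentiableWithinAt,
    formInChart_self, fieldInChart_self] at h2
  refine h1.trans ?_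
  refine Eq.trans ?_ (congrArg₂ (· - ·) h2 h3).symm
  have aux : ∀ (A : E →L[ℝ] E →L[ℝ] ℝ) (B C : E →L[ℝ] E) (a : E →L[ℝ] ℝ) (X Y : E),
      A X Y + a (C Y) = (a.comp B + A.flip Y) X - a (B X - C Y) := by
    intros; simp
  exact aux _ _ _ _ _ _

end StableDJ
end

/-! ### Leibniz rules for combinations of fields with function coefficients. -/

noncomputable section

namespace StableDJ

variable {E : Type*} [NormedAddCommGroup E] [NormedSpace ℝ E]
  {H : Type*} [TopologicalSpace H] {I : ModelWithCorners ℝ E H}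
  {M : Type*} [TopologicalSpace M] [ChartedSpace H M] [IsManifold I ∞ M]
  {ι : Type*} {x : M}

lemma MDiffFieldAt.add {X Y : Π x : M, TangentSpace I x}
    (hX : MDiffFieldAt I X x) (hY : MDiffFieldAt I Y x) : MDiffFieldAt I (X + Y) x := by
  have : IsManifold I 1 M := .of_le (n := ∞) (by simp)
  exact mdifferentiableAt_add_section hX hY

lemma MDiffFieldAt.smul {f : M → ℝ} {X : Π x : M, TangentSpace I x}
    (hf : MDifferentiableAt I 𝓘(ℝ) f x) (hX : MDiffFieldAt I X x) : MDiffFieldAt I (f • X) x := by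
  have : IsManifold I 1 M := .of_le (n := ∞) (by simp)
  exact hf.smul_section hX

lemma MDiffFieldAt.zero : MDiffFieldAt I (0 : Π x : M, TangentSpace I x) x := by
  have : IsManifold I 1 M := .of_le (n := ∞) (by simp)
  exact (contMDiff_zeroSection ℝ (TangentSpace I : M → Type _) (n := 1)
    (IB := I)).contMDiffAt.mdifferentiableAt one_ne_zero

lemma MDiffFieldAt.sum_smul (s : Finset ι) {w : ι → M → ℝ} {V : ι → Π x : M, TangentSpace I x}
    (hw : ∀ p, MDifferentiableAt I 𝓘(ℝ) (w p) x) (hV : ∀ p, MDiffFieldAt I (V p) x) :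
    MDiffFieldAt I (∑ p ∈ s, w p • V p) x := by
  classical
  induction s using Finset.induction_on with
  | empty => simpa using MDiffFieldAt.zero
  | insert a s ha ih => rw [Finset.sum_insert ha]; exact (MDiffFieldAt.smul (hw a) (hV a)).add ih

/-- Every tangent vector extends to a vector field that is differentiable at its base point. -/
lemma exists_mdiffFieldAt_eq (v : TangentSpace I x) :
    ∃ Y : Π x : M, TangentSpace I x, MDiffFieldAt I Y x ∧ Y x = v := by
  have : IsManifold I 1 M := .of_le (n := ∞) (by simp)
  exact ⟨FiberBundle.extend E v, FiberBundle.mdifferentiableAt_extend I E v, by simp⟩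

section

variable [CompleteSpace E]

lemma mlieBracket_sum_smul_left (s : Finset ι) {w : ι → M → ℝ} {V : ι → Π x : M, TangentSpace I x}
    (hw : ∀ p, MDifferentiableAt I 𝓘(ℝ) (w p) x) (hV : ∀ p, MDiffFieldAt I (V p) x)
    (Y : Π x : M, TangentSpace I x) :
    mlieBracket I (∑ p ∈ s, w p • V p) Y x =
      ∑ p ∈ s, w p x • mlieBracket I (V p) Y x - ∑ p ∈ s, mvfderiv I (w p) x (Y x) • V p x := by
  have : IsManifold I 2 M := .of_le (n := ∞) (by norm_cast)
  classical
  induction s using Finset.induction_on with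
  | empty => simp
  | insert a s ha ih =>
    rw [Finset.sum_insert ha, mlieBracket_add_left (MDiffFieldAt.smul (hw a) (hV a))
      (MDiffFieldAt.sum_smul s hw hV), ih,
      mlieBracket_smul_left (hw a) (hV a), Finset.sum_insert ha, Finset.sum_insert ha]
    module

lemma mlieBracket_sub_sum_smul_left [Fintype ι] {w : ι → M → ℝ}
    {V : ι → Π x : M, TangentSpace I x} {X : Π x : M, TangentSpace I x}
    (hX : MDiffFieldAt I X x)
    (hw : ∀ p, MDifferentiableAt I 𝓘(ℝ) (w p) x) (hV : ∀ p, MDiffFieldAt I (V p) x)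
    (Y : Π x : M, TangentSpace I x) :
    mlieBracket I (fun y ↦ X y - ∑ p, w p y • V p y) Y x =
      mlieBracket I X Y x - ∑ p, w p x • mlieBracket I (V p) Y x
        + ∑ p, mvfderiv I (w p) x (Y x) • V p x := by
  have : IsManifold I 2 M := .of_le (n := ∞) (by norm_cast)
  have hS := MDiffFieldAt.sum_smul Finset.univ hw hV
  have h : (fun y ↦ X y - ∑ p, w p y • V p y) = X + (-1 : ℝ) • ∑ p, w p • V p := by
    ext1 y
    simp [Finset.sum_apply, sub_eq_add_neg]
  have h1 : MDiffFieldAt I ((-1 : ℝ) • ∑ p, w p • V p) x :=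
    .smul (f := fun _ ↦ -1) mdifferentiableAt_const hS
  rw [h, mlieBracket_add_left hX h1, mlieBracket_const_smul_left hS,
    mlieBracket_sum_smul_left _ hw hV]
  module

omit [CompleteSpace E] [IsManifold I ∞ M] in
lemma mvfderiv_sub_sum_mul [Fintype ι] {f : M → ℝ} {g k : ι → M → ℝ}
    (hf : MDifferentiableAt I 𝓘(ℝ) f x) (hg : ∀ p, MDifferentiableAt I 𝓘(ℝ) (g p) x)
    (hk : ∀ p, MDifferentiableAt I 𝓘(ℝ) (k p) x) :
    MDifferentiableAt I 𝓘(ℝ) (fun y ↦ f y - ∑ p, g p y * k p y) x ∧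
    mvfderiv I (fun y ↦ f y - ∑ p, g p y * k p y) x =
      mvfderiv I f x - ∑ p, g p x • mvfderiv I (k p) x - ∑ p, k p x • mvfderiv I (g p) x := by
  have key : ∀ s : Finset ι, MDifferentiableAt I 𝓘(ℝ) (fun y ↦ ∑ p ∈ s, g p y * k p y) x ∧
      mvfderiv I (fun y ↦ ∑ p ∈ s, g p y * k p y) x =
      ∑ p ∈ s, g p x • mvfderiv I (k p) x + ∑ p ∈ s, k p x • mvfderiv I (g p) x := by
    intro s
    classical
    induction s using Finset.induction_on with
    | empty => simpa using ⟨mdifferentiableAt_const, mvfderiv_const 0⟩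
    | insert a s ha ih =>
      have h1 : MDifferentiableAt I 𝓘(ℝ) (fun y ↦ g a y * k a y) x := (hg a).mul (hk a)
      simp only [Finset.sum_insert ha]
      refine ⟨h1.add ih.1, ?_⟩
      rw [mvfderiv_fun_add h1 ih.1, ih.2, mvfderiv_fun_mul (hg a) (hk a)]
      module
  obtain ⟨h1, h2⟩ := key Finset.univ
  refine ⟨hf.sub h1, ?_⟩
  rw [mvfderiv_fun_sub hf h1, h2]
  module

lemma lieDerivForm_sub_sum_smul [Fintype ι] {w : ι → M → ℝ}
    {V : ι → Π x : M, TangentSpace I x} {X : Π x : M, TangentSpace I x}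
    {α : Π x : M, TangentSpace I x →L[ℝ] ℝ}
    (hX : MDiffFieldAt I X x) (hα : MDiffFormAt I α x)
    (hw : ∀ p, MDifferentiableAt I 𝓘(ℝ) (w p) x) (hV : ∀ p, MDiffFieldAt I (V p) x) :
    lieDerivForm I (fun y ↦ X y - ∑ p, w p y • V p y) α x =
      lieDerivForm I X α x - ∑ p, w p x • lieDerivForm I (V p) α x
        - ∑ p, α x (V p x) • mvfderiv I (w p) x := by
  ext v
  -- The values at `v` depend on no extension, so any field through `v` may be used in Cartan's
  -- formula.
  obtain ⟨Y, hY, rfl⟩ := exists_mdiffFieldAt_eq v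
  simp only [sub_apply, sum_apply, smul_apply]
  simp only [lieDerivForm_apply hα hY, mlieBracket_sub_sum_smul_left hX hw hV, map_sub, map_add,
    map_sum, map_smul, smul_eq_mul, mul_sub, Finset.sum_sub_distrib, mul_comm (α x _)]
  ring

end

omit [IsManifold I ∞ M] in
lemma mvfderiv_apply_coord {m : ℕ} {u : M → Fin m → ℝ}
    (hu : MDifferentiableAt I 𝓘(ℝ, Fin m → ℝ) u x) (i : Fin m) (v : TangentSpace I x) :
    mvfderiv I u x v i = mvfderiv I (fun y ↦ u y i) x v := by
  let L : (Fin m → ℝ) →L[ℝ] ℝ := ContinuousLinearMap.proj i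
  have h3 := (L.hasMFDerivAt.comp x hu.hasMFDerivAt).mfderiv
  exact (congrArg (fun A : E →L[ℝ] ℝ ↦ A v) h3).symm

end StableDJ
end

/-! ### The prolongation as an image: isotropy, maximality, smooth frames. -/

noncomputable section

namespace StableDJ

variable {E : Type*} [NormedAddCommGroup E] [NormedSpace ℝ E]
  {H : Type*} [TopologicalSpace H] {I : ModelWithCorners ℝ E H}
  {M : Type*} [TopologicalSpace M] [ChartedSpace H M]
  {h k : ℕ} {x : M}

/-- The linear map `((X, u) ⊕ (α, v), w) ↦ (X - w · V, u, α(V)) ⊕ (α, v, w)` whose image of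
`J × ℝᵏ` is the prolongation of `J`. -/
def prolongMap (V : Fin k → Π x : M, TangentSpace I x) (x : M) :
    BigTangent I h x × (Fin k → ℝ) →ₗ[ℝ] BigTangent I (h + k) x where
  toFun z := ((z.1.1.1 - ∑ p, z.2 p • V p x, Fin.append z.1.1.2 (fun p ↦ z.1.2.1 (V p x))),
    (z.1.2.1, Fin.append z.1.2.2 z.2))
  map_add' z z' := by
    ext1 <;> ext1
    · simp only [Prod.fst_add, Prod.snd_add, Pi.add_apply, add_smul, Finset.sum_add_distrib]
      abel
    · funext i; refine Fin.addCases (fun j ↦ ?_) (fun j ↦ ?_) i <;> simp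
    · simp
    · funext i; refine Fin.addCases (fun j ↦ ?_) (fun j ↦ ?_) i <;> simp
  map_smul' r z := by
    ext1 <;> ext1
    · simp only [Prod.smul_fst, Prod.smul_snd, Pi.smul_apply, smul_sub, Finset.smul_sum, smul_smul,
        smul_eq_mul, RingHom.id_apply]
    · funext i; refine Fin.addCases (fun j ↦ ?_) (fun j ↦ ?_) i <;> simp
    · simp
    · funext i; refine Fin.addCases (fun j ↦ ?_) (fun j ↦ ?_) i <;> simp

lemma prolongMap_apply (V : Fin k → Π x : M, TangentSpace I x) (x : M)
    (a : BigTangent I h x) (w : Fin k → ℝ) :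
    prolongMap V x (a, w) =
      ((a.1.1 - ∑ p, w p • V p x, Fin.append a.1.2 (fun p ↦ a.2.1 (V p x))),
        (a.2.1, Fin.append a.2.2 w)) := rfl

/-- The base component of a preimage under `prolongMap`. -/
def unprolong (V : Fin k → Π x : M, TangentSpace I x) (x : M) (z : BigTangent I (h + k) x) :
    BigTangent I h x :=
  ((z.1.1 + ∑ p, z.2.2 (Fin.natAdd h p) • V p x, fun i ↦ z.1.2 (Fin.castAdd k i)),
    (z.2.1, fun i ↦ z.2.2 (Fin.castAdd k i)))

lemma unprolong_prolongMap (V : Fin k → Π x : M, TangentSpace I x) (x : M)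
    (a : BigTangent I h x) (w : Fin k → ℝ) : unprolong V x (prolongMap V x (a, w)) = a := by
  simp [unprolong, prolongMap_apply]

/-- The hypothesis `hz` is the equation of the range of `prolongMap`. -/
lemma prolongMap_unprolong {V : Fin k → Π x : M, TangentSpace I x} {x : M}
    {z : BigTangent I (h + k) x} (hz : ∀ p, z.1.2 (Fin.natAdd h p) = z.2.1 (V p x)) :
    prolongMap V x (unprolong V x z, fun p ↦ z.2.2 (Fin.natAdd h p)) = z := by
  rw [prolongMap_apply]
  ext1 <;> ext1
  · simp [unprolong]
  · funext i; refine Fin.addCases (fun j ↦ ?_) (fun j ↦ ?_) i <;> simp [unprolong, hz]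
  · rfl
  · funext i; refine Fin.addCases (fun j ↦ ?_) (fun j ↦ ?_) i <;> simp [unprolong]

lemma prolongMap_injective (V : Fin k → Π x : M, TangentSpace I x) (x : M) :
    Function.Injective (prolongMap (h := h) V x) := by
  rintro ⟨a, w⟩ ⟨b, w'⟩ he
  have h1 : a = b := by
    rw [← unprolong_prolongMap V x a w, he, unprolong_prolongMap]
  have h2 : w = w' := by
    funext p
    have := congrArg (fun z : BigTangent I (h + k) x ↦ z.2.2 (Fin.natAdd h p)) he
    simpa [prolongMap_apply] using this
  rw [h1, h2]

lemma prolongation_eq_map (J : Π x : M, Submodule ℝ (BigTangent I h x))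
    (V : Fin k → Π x : M, TangentSpace I x) (x : M) :
    prolongation I J V x = ((J x).prod ⊤).map (prolongMap V x) := by
  ext z
  constructor
  · rintro ⟨X, u, α, v, w, hJ, rfl⟩
    exact ⟨(((X, u), (α, v)), w), ⟨hJ, trivial⟩, rfl⟩
  · rintro ⟨⟨⟨⟨X, u⟩, ⟨α, v⟩⟩, w⟩, ⟨hJ, -⟩, rfl⟩
    exact ⟨X, u, α, v, w, hJ, rfl⟩

lemma mem_prolongation_iff (J : Π x : M, Submodule ℝ (BigTangent I h x))
    (V : Fin k → Π x : M, TangentSpace I x) (x : M) (z : BigTangent I (h + k) x) :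
    z ∈ prolongation I J V x ↔
      unprolong V x z ∈ J x ∧ ∀ p, z.1.2 (Fin.natAdd h p) = z.2.1 (V p x) := by
  rw [prolongation_eq_map]
  constructor
  · rintro ⟨⟨a, w⟩, ⟨hJ, -⟩, rfl⟩
    rw [unprolong_prolongMap]
    exact ⟨hJ, fun p ↦ by simp [prolongMap_apply]⟩
  · rintro ⟨hJ, hz⟩
    exact ⟨_, ⟨hJ, trivial⟩, prolongMap_unprolong hz⟩

lemma metricG_prolongMap (V : Fin k → Π x : M, TangentSpace I x) (x : M)
    (a b : BigTangent I h x) (w w' : Fin k → ℝ) :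
    metricG I (prolongMap V x (a, w)) (prolongMap V x (b, w')) = metricG I a b := by
  simp only [metricG, prolongMap_apply, dotProduct, Fin.sum_univ_add, Fin.append_left,
    Fin.append_right, map_sub, map_sum, map_smul, smul_eq_mul, mul_comm (w _), mul_comm (w' _)]
  ring

lemma maximal_isotropic_prolongation {J : Π x : M, Submodule ℝ (BigTangent I h x)}
    (V : Fin k → Π x : M, TangentSpace I x) {x : M} (hJ : Maximal (IsIsotropic I) (J x)) :
    Maximal (IsIsotropic I) (prolongation I J V x) := by
  rw [prolongation_eq_map]
  constructor
  · rintro _ ⟨⟨a, w⟩, ⟨ha, -⟩, rfl⟩ _ ⟨⟨b, w'⟩, ⟨hb, -⟩, rfl⟩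
    rw [metricG_prolongMap]
    exact hJ.1 a ha b hb
  · intro T hT hle z hz
    have hzV : ∀ p, z.1.2 (Fin.natAdd h p) = z.2.1 (V p x) := by
      intro p
      -- The test vector is (-V_p, 0) ⊕ (0, e_p); its pairing with `z` is half the difference of the
      -- two sides of the goal.
      have h1 := hT _ hz _ (hle ⟨((0 : BigTangent I h x), Pi.single p 1),
        ⟨(J x).zero_mem, trivial⟩, rfl⟩)
      simp only [metricG, prolongMap_apply, dotProduct, Fin.sum_univ_add, Fin.append_left,
        Fin.append_right, Prod.fst_zero, Prod.snd_zero, map_sub, map_sum, map_smul, smul_eq_mul,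
        Pi.single_apply, Pi.zero_apply, zero_apply, map_zero, ite_mul, mul_ite, one_mul, mul_one,
        mul_zero, zero_mul, Finset.sum_ite_eq', Finset.mem_univ, if_true, Finset.sum_const_zero] at h1
      linarith
    -- The `J`-parts of vectors of `T` in the range of `prolongMap` form an isotropic space
    -- containing `J x`, hence contained in it by maximality.
    have hS : IsIsotropic I ((T.comap (prolongMap V x)).map (LinearMap.fst ℝ _ _)) := by
      rintro _ ⟨⟨a, w⟩, ha, rfl⟩ _ ⟨⟨b, w'⟩, hb, rfl⟩
      rw [← hT _ ha _ hb, metricG_prolongMap]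
      rfl
    have hJS : J x ≤ (T.comap (prolongMap V x)).map (LinearMap.fst ℝ _ _) := fun a ha ↦
      ⟨(a, 0), hle ⟨(a, 0), ⟨ha, trivial⟩, rfl⟩, rfl⟩
    refine ⟨_, ⟨hJ.2 hS hJS ⟨(unprolong V x z, fun p ↦ z.2.2 (Fin.natAdd h p)), ?_, rfl⟩, trivial⟩,
      prolongMap_unprolong hzV⟩
    simpa [prolongMap_unprolong hzV] using hz

lemma contMDiffOn_fin_append {U : Set M} {u : M → Fin h → ℝ} {w : M → Fin k → ℝ}
    (hu : ContMDiffOn I 𝓘(ℝ, Fin h → ℝ) ∞ u U)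
    (hw : ∀ p, ContMDiffOn I 𝓘(ℝ) ∞ (fun y ↦ w y p) U) :
    ContMDiffOn I 𝓘(ℝ, Fin (h + k) → ℝ) ∞ (fun y ↦ Fin.append (u y) (w y)) U := by
  rw [contMDiffOn_pi_space] at hu ⊢
  intro i
  refine Fin.addCases (fun j ↦ ?_) (fun j ↦ ?_) i
  · simpa using hu j
  · simpa using hw j

variable [IsManifold I ∞ M]

lemma contMDiffOn_form_apply {α : Π x : M, TangentSpace I x →L[ℝ] ℝ}
    {V : Π x : M, TangentSpace I x} {U : Set M}
    (hα : ContMDiffOn I (I.prod 𝓘(ℝ, E →L[ℝ] ℝ)) ∞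
      (fun x ↦ TotalSpace.mk' (E →L[ℝ] ℝ) (E := fun y : M ↦ TangentSpace I y →L[ℝ] ℝ) x (α x)) U)
    (hV : ContMDiffOn I I.tangent ∞ (fun x ↦ (⟨x, V x⟩ : TangentBundle I M)) U) :
    ContMDiffOn I 𝓘(ℝ) ∞ (fun y ↦ α y (V y)) U := by
  intro x hx
  have := ContMDiffOn.clm_bundle_apply (F₁ := E) (E₁ := fun y : M ↦ TangentSpace I y)
    (F₂ := ℝ) (E₂ := Bundle.Trivial M ℝ) (ϕ := α) (v := V) (b := id) hα hV x hx
  rw [contMDiffWithinAt_totalSpace] at this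
  exact this.2

lemma contMDiffOn_sum_smul {U : Set M} {w : M → Fin k → ℝ} {V : Fin k → Π x : M, TangentSpace I x}
    (hw : ∀ p, ContMDiffOn I 𝓘(ℝ) ∞ (fun y ↦ w y p) U)
    (hV : ∀ p, ContMDiffOn I I.tangent ∞ (fun x ↦ (⟨x, V p x⟩ : TangentBundle I M)) U) :
    ContMDiffOn I I.tangent ∞ (fun x ↦ (⟨x, ∑ p, w x p • V p x⟩ : TangentBundle I M)) U :=
  ContMDiffOn.sum_section (t := fun p x ↦ w x p • V p x)
    fun p _ ↦ (hw p).smul_section (hV p)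

lemma SmoothSectionOn.prolongMap {s : Π x : M, BigTangent I h x} {U : Set M}
    (hs : SmoothSectionOn I s U) {w : M → Fin k → ℝ}
    (hw : ContMDiffOn I 𝓘(ℝ, Fin k → ℝ) ∞ w U) {V : Fin k → Π x : M, TangentSpace I x}
    (hV : ∀ p, ContMDiffOn I I.tangent ∞ (fun x ↦ (⟨x, V p x⟩ : TangentBundle I M)) U) :
    SmoothSectionOn I (fun x ↦ prolongMap V x (s x, w x)) U := by
  obtain ⟨hX, hu, hα, hv⟩ := hs
  have hw' := contMDiffOn_pi_space.1 hw
  exact ⟨hX.sub_section (contMDiffOn_sum_smul hw' hV),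
    contMDiffOn_fin_append hu fun p ↦ contMDiffOn_form_apply hα (hV p), hα,
    contMDiffOn_fin_append hv hw'⟩

lemma SmoothSectionOn.unprolong {s : Π x : M, BigTangent I (h + k) x} {U : Set M}
    (hs : SmoothSectionOn I s U) {V : Fin k → Π x : M, TangentSpace I x}
    (hV : ∀ p, ContMDiffOn I I.tangent ∞ (fun x ↦ (⟨x, V p x⟩ : TangentBundle I M)) U) :
    SmoothSectionOn I (fun x ↦ unprolong V x (s x)) U := by
  obtain ⟨hX, hu, hα, hv⟩ := hs
  rw [contMDiffOn_pi_space] at hu hv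
  exact ⟨hX.add_section
      (contMDiffOn_sum_smul (w := fun x p ↦ (s x).2.2 (Fin.natAdd h p)) (fun p ↦ hv _) hV),
    contMDiffOn_pi_space.2 fun i ↦ hu _, hα, contMDiffOn_pi_space.2 fun i ↦ hv _⟩

lemma SmoothSectionOn.zero (U : Set M) :
    SmoothSectionOn I (fun x ↦ (0 : BigTangent I h x)) U :=
  ⟨(contMDiff_zeroSection ℝ (TangentSpace I : M → Type _)).contMDiffOn, contMDiffOn_const,
    (contMDiff_zeroSection ℝ (fun y : M ↦ TangentSpace I y →L[ℝ] ℝ)).contMDiffOn,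
    contMDiffOn_const⟩

lemma isSmoothSubbundle_prolongation {J : Π x : M, Submodule ℝ (BigTangent I h x)}
    (hJ : IsSmoothSubbundle I J) {V : Fin k → Π x : M, TangentSpace I x}
    (hV : ∀ p, ContMDiff I I.tangent ∞ (fun x ↦ (⟨x, V p x⟩ : TangentBundle I M))) :
    IsSmoothSubbundle I (prolongation I J V) := by
  intro x₀
  obtain ⟨U, hU, hx₀, r, s, hs, hspan⟩ := hJ x₀
  let e : Fin k → Fin k → ℝ := fun p ↦ Pi.single p 1
  have he : LinearIndependent ℝ e := Pi.linearIndependent_single_one _ _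
  have hetop : Submodule.span ℝ (range e) = ⊤ := by
    have := (Pi.basisFun ℝ (Fin k)).span_eq
    rwa [show ⇑(Pi.basisFun ℝ (Fin k)) = e from funext fun p ↦ Pi.basisFun_apply ..] at this
  refine ⟨U, hU, hx₀, r + k, fun i x ↦ prolongMap V x
    (Sum.elim (fun i ↦ (s i x, 0)) (fun p ↦ (0, e p)) (finSumFinEquiv.symm i)), fun i ↦ ?_,
    fun x hx ↦ ?_⟩
  · obtain ⟨j | p, rfl⟩ := finSumFinEquiv.surjective i
    · simpa using! (hs j).prolongMap (w := fun _ ↦ 0) contMDiffOn_const fun p ↦ (hV p).contMDiffOn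
    · simpa using! (SmoothSectionOn.zero U).prolongMap (w := fun _ ↦ e p)
        contMDiffOn_const fun p ↦ (hV p).contMDiffOn
  · obtain ⟨hli, hsp⟩ := hspan x hx
    have hpair : LinearIndependent ℝ (Sum.elim (fun i ↦ (s i x, (0 : Fin k → ℝ)))
        (fun p ↦ ((0 : BigTangent I h x), e p))) :=
      linearIndependent_inl_union_inr' hli he
    constructor
    · exact (hpair.comp _ finSumFinEquiv.symm.injective).map' _
        (LinearMap.ker_eq_bot.2 (prolongMap_injective V x))
    · rw [prolongation_eq_map, ← hsp, ← hetop, ← LinearMap.span_inl_union_inr, Submodule.map_span]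
      congr 1
      rw [show (fun i ↦ prolongMap V x (Sum.elim (fun i ↦ (s i x, 0)) (fun p ↦ (0, e p))
        (finSumFinEquiv.symm i))) = prolongMap V x ∘ (Sum.elim (fun i ↦ (s i x, 0))
        (fun p ↦ (0, e p)) ∘ finSumFinEquiv.symm) from rfl, range_comp,
        EquivLike.range_comp, Sum.elim_range]
      exact congrArg (prolongMap V x '' ·) (congrArg₂ (· ∪ ·)
        (range_comp (LinearMap.inl ℝ _ (Fin k → ℝ)) (s · x)) (range_comp (LinearMap.inr ℝ _ _) e))

end StableDJ
end

/-! ### The Wade bracket of prolonged sections. -/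

noncomputable section

namespace StableDJ

variable {E : Type*} [NormedAddCommGroup E] [NormedSpace ℝ E] [CompleteSpace E]
  {H : Type*} [TopologicalSpace H] {I : ModelWithCorners ℝ E H}
  {M : Type*} [TopologicalSpace M] [ChartedSpace H M] [IsManifold I ∞ M]
  {ι : Type*} [Fintype ι] {h k : ℕ} {x : M}

/-- The terms are grouped so that the last sum is the one `unprolong` adds back: its coefficients
are the derivative part of the new `w`. -/
lemma mlieBracket_sub_sum_smul {X₁ X₂ : Π x : M, TangentSpace I x}
    {V : ι → Π x : M, TangentSpace I x} {w₁ w₂ : ι → M → ℝ}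
    (hX₁ : MDiffFieldAt I X₁ x) (hX₂ : MDiffFieldAt I X₂ x) (hV : ∀ p, MDiffFieldAt I (V p) x)
    (hw₁ : ∀ p, MDifferentiableAt I 𝓘(ℝ) (w₁ p) x) (hw₂ : ∀ p, MDifferentiableAt I 𝓘(ℝ) (w₂ p) x)
    (hcomm : ∀ p q, mlieBracket I (V p) (V q) x = 0) :
    mlieBracket I (fun y ↦ X₁ y - ∑ p, w₁ p y • V p y) (fun y ↦ X₂ y - ∑ p, w₂ p y • V p y) x =
      mlieBracket I X₁ X₂ x + ∑ p, w₂ p x • mlieBracket I (V p) X₁ x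
        - ∑ p, w₁ p x • mlieBracket I (V p) X₂ x
        - ∑ p, (mvfderiv I (w₂ p) x (X₁ x - ∑ p, w₁ p x • V p x)
          - mvfderiv I (w₁ p) x (X₂ x - ∑ p, w₂ p x • V p x)) • V p x := by
  have right : ∀ Z : Π x : M, TangentSpace I x,
      mlieBracket I Z (fun y ↦ X₂ y - ∑ p, w₂ p y • V p y) x =
        mlieBracket I Z X₂ x + ∑ p, w₂ p x • mlieBracket I (V p) Z x
          - ∑ p, mvfderiv I (w₂ p) x (Z x) • V p x := by
    intro Z
    rw [mlieBracket_swap_apply, mlieBracket_sub_sum_smul_left hX₂ hw₂ hV,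
      mlieBracket_swap_apply (V := X₂)]
    module
  have swap : ∑ p, w₁ p x • ∑ q, mvfderiv I (w₂ q) x (V p x) • V q x =
      ∑ q, (∑ p, w₁ p x * mvfderiv I (w₂ q) x (V p x)) • V q x := by
    simp only [Finset.smul_sum, smul_smul, Finset.sum_smul]
    exact Finset.sum_comm
  rw [mlieBracket_sub_sum_smul_left hX₁ hw₁ hV, right]
  simp only [right, hcomm, smul_zero, Finset.sum_const_zero, add_zero, smul_sub, sub_smul,
    Finset.sum_sub_distrib, swap, map_sub, map_sum, map_smul, smul_eq_mul]
  module

/-- The last half-sum on the left is what the `k` new coordinates add to the bracket. Since L_{wV} α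
= w L_V α + α(V) dw, the α(V) dw terms cancel against it and the differential of w α(V), leaving
only the w L_V α. -/
lemma wadeForm_sub_sum_smul {X₁ X₂ : Π x : M, TangentSpace I x}
    {α₁ α₂ : Π x : M, TangentSpace I x →L[ℝ] ℝ}
    {V : ι → Π x : M, TangentSpace I x} {w₁ w₂ : ι → M → ℝ}
    (hX₁ : MDiffFieldAt I X₁ x) (hX₂ : MDiffFieldAt I X₂ x)
    (hα₁ : MDiffFormAt I α₁ x) (hα₂ : MDiffFormAt I α₂ x) (hV : ∀ p, MDiffFieldAt I (V p) x)
    (hw₁ : ∀ p, MDifferentiableAt I 𝓘(ℝ) (w₁ p) x) (hw₂ : ∀ p, MDifferentiableAt I 𝓘(ℝ) (w₂ p) x) :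
    lieDerivForm I (fun y ↦ X₁ y - ∑ p, w₁ p y • V p y) α₂ x
      - lieDerivForm I (fun y ↦ X₂ y - ∑ p, w₂ p y • V p y) α₁ x
      + (1 / 2 : ℝ) • mvfderiv I (fun y ↦ α₁ y (X₂ y - ∑ p, w₂ p y • V p y)
        - α₂ y (X₁ y - ∑ p, w₁ p y • V p y)) x
      + (1 / 2 : ℝ) • (∑ p, α₂ x (V p x) • mvfderiv I (w₁ p) x
        + ∑ p, w₂ p x • mvfderiv I (fun y ↦ α₁ y (V p y)) x
        - ∑ p, α₁ x (V p x) • mvfderiv I (w₂ p) x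
        - ∑ p, w₁ p x • mvfderiv I (fun y ↦ α₂ y (V p y)) x) =
    lieDerivForm I X₁ α₂ x - lieDerivForm I X₂ α₁ x
      + (1 / 2 : ℝ) • mvfderiv I (fun y ↦ α₁ y (X₂ y) - α₂ y (X₁ y)) x
      + ∑ p, w₂ p x • lieDerivForm I (V p) α₁ x - ∑ p, w₁ p x • lieDerivForm I (V p) α₂ x := by
  have expand : (fun y ↦ α₁ y (X₂ y - ∑ p, w₂ p y • V p y)
      - α₂ y (X₁ y - ∑ p, w₁ p y • V p y)) =
      fun y ↦ (α₁ y (X₂ y) - ∑ p, w₂ p y * α₁ y (V p y))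
        - (α₂ y (X₁ y) - ∑ p, w₁ p y * α₂ y (V p y)) := by
    funext y
    simp only [map_sub, map_sum, map_smul, smul_eq_mul]
  obtain ⟨h₁, e₁⟩ := mvfderiv_sub_sum_mul (hα₁.apply hX₂) hw₂ fun p ↦ hα₁.apply (hV p)
  obtain ⟨h₂, e₂⟩ := mvfderiv_sub_sum_mul (hα₂.apply hX₁) hw₁ fun p ↦ hα₂.apply (hV p)
  rw [expand, mvfderiv_fun_sub h₁ h₂, e₁, e₂, mvfderiv_fun_sub (hα₁.apply hX₂) (hα₂.apply hX₁),
    lieDerivForm_sub_sum_smul hX₁ hα₂ hw₁ hV, lieDerivForm_sub_sum_smul hX₂ hα₁ hw₂ hV]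
  module

omit [CompleteSpace E] [IsManifold I ∞ M] in
lemma dotD_append {u u' : M → Fin h → ℝ} {w w' : M → Fin k → ℝ} :
    dotD I (fun y ↦ Fin.append (u y) (w y)) (fun y ↦ Fin.append (u' y) (w' y)) x =
      dotD I u u' x + ∑ p, w x p • mvfderiv I (fun y ↦ w' y p) x := by
  simp [dotD, Fin.sum_univ_add]

omit [CompleteSpace E] [IsManifold I ∞ M] in
lemma dotProduct_append {u u' : Fin h → ℝ} {w w' : Fin k → ℝ} :
    Fin.append u w ⬝ᵥ Fin.append u' w' = u ⬝ᵥ u' + w ⬝ᵥ w' := by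
  simp [dotProduct, Fin.sum_univ_add]

/-- The infinitesimal action of a vector field `V` on sections of the stable big tangent bundle
that appears in the twisted invariance condition. -/
def twistedLie (c : Fin h → ℝ) (V : Π x : M, TangentSpace I x) (s : Π x : M, BigTangent I h x)
    (x : M) : BigTangent I h x :=
  ((mlieBracket I V (fun y ↦ (s y).1.1) x + (c ⬝ᵥ (s x).1.2) • V x,
      mvfderiv I (fun y ↦ (s y).1.2) x (V x)),
    (lieDerivForm I V (fun y ↦ (s y).2.1) x,
      mvfderiv I (fun y ↦ (s y).2.2) x (V x) - (s x).2.1 (V x) • c))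

/-- Differentiability at a point of a section of the stable big tangent bundle. -/
structure MDiffSectionAt (s : Π x : M, BigTangent I h x) (x : M) : Prop where
  field : MDiffFieldAt I (fun y ↦ (s y).1.1) x
  fst : MDifferentiableAt I 𝓘(ℝ, Fin h → ℝ) (fun y ↦ (s y).1.2) x
  form : MDiffFormAt I (fun y ↦ (s y).2.1) x
  snd : MDifferentiableAt I 𝓘(ℝ, Fin h → ℝ) (fun y ↦ (s y).2.2) x

omit [CompleteSpace E] in
lemma SmoothSectionOn.mdiffSectionAt {s : Π x : M, BigTangent I h x}
    (hs : SmoothSectionOn I s univ) (x : M) : MDiffSectionAt s x := by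
  obtain ⟨h1, h2, h3, h4⟩ := hs
  exact ⟨(contMDiffOn_univ.1 h1).mdifferentiable (by simp) x,
    (contMDiffOn_univ.1 h2).mdifferentiable (by simp) x,
    (contMDiffOn_univ.1 h3).mdifferentiable (by simp) x,
    (contMDiffOn_univ.1 h4).mdifferentiable (by simp) x⟩

section

variable (c : Fin h → ℝ) {V : Fin k → Π x : M, TangentSpace I x} {s₁ s₂ : Π x : M, BigTangent I h x}
  {w₁ w₂ : M → Fin k → ℝ}

lemma wadeBracket_prolongMap_form (hV : ∀ p, MDiffFieldAt I (V p) x)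
    (hs₁ : MDiffSectionAt s₁ x) (hs₂ : MDiffSectionAt s₂ x)
    (hw₁ : ∀ p, MDifferentiableAt I 𝓘(ℝ) (fun y ↦ w₁ y p) x)
    (hw₂ : ∀ p, MDifferentiableAt I 𝓘(ℝ) (fun y ↦ w₂ y p) x) :
    (wadeBracket I (Fin.append c (0 : Fin k → ℝ)) (fun y ↦ prolongMap V y (s₁ y, w₁ y))
      (fun y ↦ prolongMap V y (s₂ y, w₂ y)) x).2.1 =
    (wadeBracket I c s₁ s₂ x).2.1 + ∑ p, w₂ x p • lieDerivForm I (V p) (fun y ↦ (s₁ y).2.1) x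
      - ∑ p, w₁ x p • lieDerivForm I (V p) (fun y ↦ (s₂ y).2.1) x := by
  have key := wadeForm_sub_sum_smul hs₁.field hs₂.field hs₁.form hs₂.form hV hw₁ hw₂
  simp only [wadeBracket, prolongMap_apply, dotD_append, dotProduct_append, zero_dotProduct,
    add_zero]
  rw [← sub_eq_zero] at key ⊢
  refine Eq.trans ?_ key
  module

omit [CompleteSpace E] in
lemma wadeBracket_prolongMap_fst_natAdd
    (hs₁ : MDiffSectionAt (fun y ↦ prolongMap V y (s₁ y, w₁ y)) x)
    (hs₂ : MDiffSectionAt (fun y ↦ prolongMap V y (s₂ y, w₂ y)) x) (p : Fin k) :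
    (wadeBracket I (Fin.append c (0 : Fin k → ℝ)) (fun y ↦ prolongMap V y (s₁ y, w₁ y))
      (fun y ↦ prolongMap V y (s₂ y, w₂ y)) x).1.2 (Fin.natAdd h p) =
    mvfderiv I (fun y ↦ (s₂ y).2.1 (V p y)) x ((s₁ x).1.1 - ∑ p, w₁ x p • V p x)
      - mvfderiv I (fun y ↦ (s₁ y).2.1 (V p y)) x ((s₂ x).1.1 - ∑ p, w₂ x p • V p x) := by
  have h1 := hs₁.fst
  have h2 := hs₂.fst
  simp only [wadeBracket, Pi.sub_apply]
  rw [mvfderiv_apply_coord h1 _ _, mvfderiv_apply_coord h2 _ _]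
  simp only [prolongMap_apply, Fin.append_right]

lemma unprolong_wadeBracket (hV : ∀ p, MDiffFieldAt I (V p) x)
    (hcomm : ∀ p q, mlieBracket I (V p) (V q) x = 0)
    (hs₁ : MDiffSectionAt s₁ x) (hs₂ : MDiffSectionAt s₂ x)
    (hs₁' : MDiffSectionAt (fun y ↦ prolongMap V y (s₁ y, w₁ y)) x)
    (hs₂' : MDiffSectionAt (fun y ↦ prolongMap V y (s₂ y, w₂ y)) x)
    (hw₁ : ∀ p, MDifferentiableAt I 𝓘(ℝ) (fun y ↦ w₁ y p) x)
    (hw₂ : ∀ p, MDifferentiableAt I 𝓘(ℝ) (fun y ↦ w₂ y p) x) :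
    unprolong V x (wadeBracket I (Fin.append c (0 : Fin k → ℝ))
      (fun y ↦ prolongMap V y (s₁ y, w₁ y)) (fun y ↦ prolongMap V y (s₂ y, w₂ y)) x) =
    wadeBracket I c s₁ s₂ x + ∑ p, w₂ x p • twistedLie c (V p) s₁ x
      - ∑ p, w₁ x p • twistedLie c (V p) s₂ x := by
  ext1 <;> ext1
  · have key := mlieBracket_sub_sum_smul hs₁.field hs₂.field hV hw₁ hw₂ hcomm
    -- These are the `w`-coordinates of the bracket. The multiple of dτ drops out because `c` is
    -- extended by zero; the terms in c · u yield the twist dτ(u) V_p.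
    have snd_natAdd : ∀ p, (wadeBracket I (Fin.append c (0 : Fin k → ℝ))
        (fun y ↦ prolongMap V y (s₁ y, w₁ y)) (fun y ↦ prolongMap V y (s₂ y, w₂ y)) x).2.2
          (Fin.natAdd h p) =
        mvfderiv I (fun y ↦ w₂ y p) x ((s₁ x).1.1 - ∑ p, w₁ x p • V p x)
        - mvfderiv I (fun y ↦ w₁ y p) x ((s₂ x).1.1 - ∑ p, w₂ x p • V p x)
        + (c ⬝ᵥ (s₁ x).1.2) * w₂ x p - (c ⬝ᵥ (s₂ x).1.2) * w₁ x p := by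
      intro p
      simp only [wadeBracket, Pi.sub_apply, Pi.add_apply, Pi.smul_apply]
      rw [mvfderiv_apply_coord hs₁'.snd _ _, mvfderiv_apply_coord hs₂'.snd _ _]
      simp only [prolongMap_apply, Fin.append_right, dotProduct_append, zero_dotProduct, add_zero,
        Pi.zero_apply, smul_eq_mul, mul_zero]
    simp only [unprolong, snd_natAdd]
    simp only [wadeBracket, prolongMap_apply, key, twistedLie, Prod.fst_sub, Prod.fst_add,
      Prod.fst_sum, Prod.smul_fst, smul_add, add_smul, sub_smul, Finset.sum_add_distrib,
      Finset.sum_sub_distrib, smul_smul, mul_comm (w₁ x _), mul_comm (w₂ x _)]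
    abel
  · funext i
    simp only [unprolong, wadeBracket, twistedLie, Prod.fst_sub, Prod.fst_add, Prod.fst_sum,
      Prod.snd_sub, Prod.snd_add, Prod.snd_sum, Prod.smul_fst, Prod.smul_snd, Pi.sub_apply,
      Pi.add_apply, Finset.sum_apply, Pi.smul_apply]
    rw [mvfderiv_apply_coord hs₁'.fst _ _, mvfderiv_apply_coord hs₂'.fst _ _]
    simp only [mvfderiv_apply_coord hs₁.fst _ _, mvfderiv_apply_coord hs₂.fst _ _,
      prolongMap_apply, Fin.append_left, map_sub, map_sum, map_smul, smul_eq_mul]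
    ring
  · refine (wadeBracket_prolongMap_form c hV hs₁ hs₂ hw₁ hw₂).trans ?_
    simp only [twistedLie, Prod.snd_sub, Prod.snd_add, Prod.snd_sum, Prod.fst_sub, Prod.fst_add,
      Prod.fst_sum, Prod.smul_fst, Prod.smul_snd]
  · funext i
    simp only [unprolong, wadeBracket, twistedLie, Prod.snd_sub, Prod.snd_add, Prod.snd_sum,
      Prod.smul_snd, Pi.sub_apply, Pi.add_apply, Finset.sum_apply, Pi.smul_apply]
    rw [mvfderiv_apply_coord hs₁'.snd _ _, mvfderiv_apply_coord hs₂'.snd _ _]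
    simp only [mvfderiv_apply_coord hs₁.snd _ _, mvfderiv_apply_coord hs₂.snd _ _,
      prolongMap_apply, Fin.append_left, map_sub, map_sum, map_smul, smul_eq_mul,
      dotProduct_append, zero_dotProduct, add_zero, mul_sub, Finset.sum_sub_distrib]
    -- w · α(V) arises both from α(X - w · V) and from the extended dot products; the two halves add
    -- up to the full term -α(V) dτ of the action.
    have e : ∀ a w : Fin k → ℝ, ∑ p, w p * (a p * c i) = (a ⬝ᵥ w) * c i := by
      intro a w
      rw [dotProduct, Finset.sum_mul]
      exact Finset.sum_congr rfl fun p _ ↦ by ring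
    have e' : ∀ a w : Fin k → ℝ, ∑ p, w p * a p = a ⬝ᵥ w := fun a w ↦ dotProduct_comm w a
    rw [e (fun p ↦ (s₁ x).2.1 (V p x)), e (fun p ↦ (s₂ x).2.1 (V p x)),
      e' (fun p ↦ (s₁ x).2.1 (V p x)), e' (fun p ↦ (s₂ x).2.1 (V p x))]
    ring

/-- The infinitesimal form of isotropy: if `s₁` and `s₂` are orthogonal to the images of each other
under the twisted action of `W`, then the form component of their bracket evaluated on `W` is
`X₁(α₂(W)) - X₂(α₁(W))`. -/
lemma wadeBracket_form_apply {W : Π x : M, TangentSpace I x} (hW : MDiffFieldAt I W x)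
    (hs₁ : MDiffSectionAt s₁ x) (hs₂ : MDiffSectionAt s₂ x)
    (h₁₂ : metricG I (twistedLie c W s₁ x) (s₂ x) = 0)
    (h₂₁ : metricG I (twistedLie c W s₂ x) (s₁ x) = 0) :
    (wadeBracket I c s₁ s₂ x).2.1 (W x) =
      mvfderiv I (fun y ↦ (s₂ y).2.1 (W y)) x (s₁ x).1.1
        - mvfderiv I (fun y ↦ (s₁ y).2.1 (W y)) x (s₂ x).1.1 := by
  have l₁₂ := lieDerivForm_apply (X := W) hs₁.form hs₂.field
  have l₂₁ := lieDerivForm_apply (X := W) hs₂.form hs₁.field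
  have m₁ := lieDerivForm_apply (X := fun y ↦ (s₁ y).1.1) hs₂.form hW
  have m₂ := lieDerivForm_apply (X := fun y ↦ (s₂ y).1.1) hs₁.form hW
  rw [mlieBracket_swap_apply, map_neg] at m₁ m₂
  have hd := mvfderiv_fun_sub (hs₁.form.apply hs₂.field) (hs₂.form.apply hs₁.field)
  simp only [metricG, twistedLie, dotProduct_sub, map_add, map_smul, smul_eq_mul,
    dotProduct_smul] at h₁₂ h₂₁
  have hdot : ∀ {a b : M → Fin h → ℝ}, MDifferentiableAt I 𝓘(ℝ, Fin h → ℝ) b x →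
      dotD I a b x (W x) = a x ⬝ᵥ mvfderiv I b x (W x) := by
    intro a b hb
    simp only [dotD, sum_apply, smul_apply, dotProduct, smul_eq_mul,
      mvfderiv_apply_coord hb _ _]
  simp only [wadeBracket, add_apply, sub_apply, smul_apply, hd, m₁, m₂, smul_eq_mul,
    hdot hs₁.fst, hdot hs₂.fst, hdot hs₁.snd, hdot hs₂.snd]
  simp only [l₁₂, l₂₁] at h₁₂ h₂₁
  rw [dotProduct_comm (mvfderiv I (fun y ↦ (s₁ y).1.2) x (W x)),
    dotProduct_comm _ c] at h₁₂
  rw [dotProduct_comm (mvfderiv I (fun y ↦ (s₂ y).1.2) x (W x)),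
    dotProduct_comm _ c] at h₂₁
  -- The two sides differ exactly by G(T s₁, s₂) - G(T s₂, s₁), with T the twisted action of `W`.
  linear_combination h₁₂ - h₂₁

end

end StableDJ
end

/-! ### Closure under the bracket, and the theorem. -/

noncomputable section

namespace StableDJ

variable {E : Type*} [NormedAddCommGroup E] [NormedSpace ℝ E] [CompleteSpace E]
  {H : Type*} [TopologicalSpace H] {I : ModelWithCorners ℝ E H}
  {M : Type*} [TopologicalSpace M] [ChartedSpace H M] [IsManifold I ∞ M]
  {h k : ℕ}

omit [CompleteSpace E] in
/-- Sections of the prolongation come from sections of `J` and `ℝᵏ`-valued functions. -/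
lemma IsSectionOf.exists_eq_prolongMap {J : Π x : M, Submodule ℝ (BigTangent I h x)}
    {V : Fin k → Π x : M, TangentSpace I x}
    (hV : ∀ p, ContMDiff I I.tangent ∞ (fun x ↦ (⟨x, V p x⟩ : TangentBundle I M)))
    {z : Π x : M, BigTangent I (h + k) x} (hz : IsSectionOf I (prolongation I J V) z) :
    ∃ (s : Π x : M, BigTangent I h x) (w : M → Fin k → ℝ), IsSectionOf I J s ∧
      (∀ p, ContMDiff I 𝓘(ℝ) ∞ (fun y ↦ w y p)) ∧ z = fun y ↦ prolongMap V y (s y, w y) := by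
  have hmem := fun x ↦ (mem_prolongation_iff J V x (z x)).1 (hz.2 x)
  exact ⟨fun x ↦ unprolong V x (z x), fun x p ↦ (z x).2.2 (Fin.natAdd h p),
    ⟨hz.1.unprolong fun p ↦ (hV p).contMDiffOn, fun x ↦ (hmem x).1⟩,
    fun p ↦ contMDiffOn_univ.1 (contMDiffOn_pi_space.1 hz.1.2.2.2 _),
    funext fun x ↦ (prolongMap_unprolong (hmem x).2).symm⟩

lemma wadeBracket_mem_prolongation {c : Fin h → ℝ} {J : Π x : M, Submodule ℝ (BigTangent I h x)}
    (hJ : IsDiracJacobi I c J) {V : Fin k → Π x : M, TangentSpace I x}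
    (hV : ∀ p, ContMDiff I I.tangent ∞ (fun x ↦ (⟨x, V p x⟩ : TangentBundle I M)))
    (hcomm : ∀ p q x, mlieBracket I (V p) (V q) x = 0)
    (hinv : ∀ p, TwistedInvariant I c J (V p))
    {z₁ z₂ : Π x : M, BigTangent I (h + k) x} (hz₁ : IsSectionOf I (prolongation I J V) z₁)
    (hz₂ : IsSectionOf I (prolongation I J V) z₂) (x : M) :
    wadeBracket I (Fin.append c (0 : Fin k → ℝ)) z₁ z₂ x ∈ prolongation I J V x := by
  obtain ⟨s₁, w₁, hs₁, hw₁, rfl⟩ := hz₁.exists_eq_prolongMap hV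
  obtain ⟨s₂, w₂, hs₂, hw₂, rfl⟩ := hz₂.exists_eq_prolongMap hV
  have dV : ∀ p, MDiffFieldAt I (V p) x := fun p ↦ (hV p).mdifferentiable (by simp) x
  have dw₁ : ∀ p, MDifferentiableAt I 𝓘(ℝ) (fun y ↦ w₁ y p) x := fun p ↦
    (hw₁ p).mdifferentiable (by simp) x
  have dw₂ : ∀ p, MDifferentiableAt I 𝓘(ℝ) (fun y ↦ w₂ y p) x := fun p ↦
    (hw₂ p).mdifferentiable (by simp) x
  have ds₁ := hs₁.1.mdiffSectionAt x
  have ds₂ := hs₂.1.mdiffSectionAt x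
  have dz₁ := hz₁.1.mdiffSectionAt x
  have dz₂ := hz₂.1.mdiffSectionAt x
  have mem₁ : ∀ p, twistedLie c (V p) s₁ x ∈ J x := fun p ↦ hinv p s₁ hs₁ x
  have mem₂ : ∀ p, twistedLie c (V p) s₂ x ∈ J x := fun p ↦ hinv p s₂ hs₂ x
  have iso := (hJ.maximal_isotropic x).1
  rw [mem_prolongation_iff, unprolong_wadeBracket c dV (fun p q ↦ hcomm p q x) ds₁ ds₂ dz₁ dz₂
    dw₁ dw₂]
  refine ⟨(J x).sub_mem ((J x).add_mem (hJ.integrable _ _ hs₁ hs₂ x)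
    ((J x).sum_mem fun p _ ↦ (J x).smul_mem _ (mem₁ p)))
    ((J x).sum_mem fun p _ ↦ (J x).smul_mem _ (mem₂ p)), fun q ↦ ?_⟩
  -- The defining equation of the range is checked next; commutation removes the bracket from
  -- Cartan's formula.
  have hlie : ∀ (s : Π x : M, BigTangent I h x) (p : Fin k), MDiffSectionAt s x →
      lieDerivForm I (V p) (fun y ↦ (s y).2.1) x (V q x) =
        mvfderiv I (fun y ↦ (s y).2.1 (V q y)) x (V p x) := by
    intro s p ds
    rw [lieDerivForm_apply ds.form (dV q), hcomm, map_zero, sub_zero]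
  rw [wadeBracket_prolongMap_fst_natAdd c dz₁ dz₂ q,
    wadeBracket_prolongMap_form c dV ds₁ ds₂ dw₁ dw₂, sub_apply, add_apply,
    wadeBracket_form_apply c (dV q) ds₁ ds₂ (iso _ (mem₁ q) _ (hs₂.2 x))
      (iso _ (mem₂ q) _ (hs₁.2 x))]
  simp only [sum_apply, smul_apply, hlie _ _ ds₁, hlie _ _ ds₂, map_sub, map_sum, map_smul]
  ring

end StableDJ
end

/-- Let `J` be an untwisted stable Dirac-Jacobi structure of index `h` on a smooth manifold `M`,
with respect to the linear function `τ = ∑ₐ cₐ tᵃ`, and let `V₁, …, V_k` be commuting smooth vector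
fields satisfying the twisted invariance condition. Then `Ĵ` is an untwisted stable Dirac-Jacobi
structure of index `h + k`, with respect to `τ` seen as a function on `ℝʰ × ℝᵏ`. -/
theorem proposition2p3 {n : ℕ} {M : Type*} [TopologicalSpace M] [T2Space M] [ParacompactSpace M]
    [ChartedSpace (EuclideanSpace ℝ (Fin n)) M] [IsManifold (𝓡 n) ∞ M]
    (h k : ℕ) (c : Fin h → ℝ)
    (J : Π x : M, Submodule ℝ (StableDJ.BigTangent (𝓡 n) h x))
    (hJ : StableDJ.IsDiracJacobi (𝓡 n) c J)
    (V : Fin k → Π x : M, TangentSpace (𝓡 n) x)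
    (hVsmooth : ∀ p, ContMDiff (𝓡 n) (𝓡 n).tangent ∞
      (fun x ↦ (⟨x, V p x⟩ : TangentBundle (𝓡 n) M)))
    (hVcomm : ∀ p q x, mlieBracket (𝓡 n) (V p) (V q) x = 0)
    (hVinv : ∀ p, StableDJ.TwistedInvariant (𝓡 n) c J (V p)) :
    StableDJ.IsDiracJacobi (𝓡 n) (Fin.append c (0 : Fin k → ℝ))
      (StableDJ.prolongation (𝓡 n) J V) := by
  exact ⟨StableDJ.isSmoothSubbundle_prolongation hJ.subbundle hVsmooth,
    fun x ↦ StableDJ.maximal_isotropic_prolongation V (hJ.maximal_isotropic x),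
    fun _ _ hz₁ hz₂ x ↦
      StableDJ.wadeBracket_mem_prolongation hJ hVsmooth hVcomm hVinv hz₁ hz₂ x⟩
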